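/- Let $p$ and $D$ be real numbers with $p>D$. Then there exists a constant $C$, depending only on $p$ and $D$, with the following property. Let $n\ge 1$ be an integer and let $A=(A_1,\dots,A_n)\in\mathbb R^n$ satisfy $A_i\ge 0$ for all $i$ and $A_1+\cdots+A_n+n=D$. Write $x^A=|x_1|^{A_1}\cdots|x_n|^{A_n}$ and $\mathbb R^n_*=\{x\in\mathbb R^n : x_i>0 \text{ whenever } A_i>0\}$, and let $\alpha=1-\frac Dp$. Then $$\sup_{x\ne y,\ x,y\in\mathbb R^n_*}\frac{|u(x)-u(y)|}{|x-y|^{\alpha}}\le C\left(\int_{\mathbb R^n_*}x^A|\nabla u|^p\,dx\right)^{1/p}$$ for all $u\in C^1_c(\mathbb R^n)$ (the $C^1$ functions on $\mathbb R^n$ with compact support). Moreover, if $\Omega\subset\mathbb R^n$ is a bounded domain and $u\in C^1_c(\Omega)$, then $$\sup_{\Omega}|u|\le C\,\operatorname{diam}(\Omega)^{1-\frac Dp}\left(\int_\Omega x^A|\nabla u|^p\,dx\right)^{1/p}.$$ -/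

import Mathlib

/-- The monomial weight `x^A = |x₁|^{A₁} ⋯ |xₙ|^{Aₙ}` on `ℝⁿ`. -/
noncomputable def monomialWeight {n : ℕ} (A : Fin n → ℝ) (x : EuclideanSpace ℝ (Fin n)) : ℝ :=
  ∏ i, |x i| ^ A i

/-- The set `ℝⁿ_*` of all `x ∈ ℝⁿ` such that `xᵢ > 0` whenever `Aᵢ > 0`. -/
def starSpace {n : ℕ} (A : Fin n → ℝ) : Set (EuclideanSpace ℝ (Fin n)) :=
  {x | ∀ i, 0 < A i → 0 < x i}

/-- The weighted norm `(∫_S x^A |∇u|^p dx)^{1/p}` of the gradient of `u`. -/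
noncomputable def weightedGradNorm {n : ℕ} (A : Fin n → ℝ) (p : ℝ)
    (S : Set (EuclideanSpace ℝ (Fin n))) (u : EuclideanSpace ℝ (Fin n) → ℝ) : ℝ :=
  (∫ x in S, monomialWeight A x * ‖gradient u x‖ ^ p) ^ (1 / p)

open MeasureTheory Set ENNReal

/-! This is Morrey's argument on cubes having `x` as a vertex and opening away from the hyperplanes
where the weight vanishes. On such a cube the weight at `x + w` is at least `w^A`, so Hölder's
inequality bounds the integral of `|∇u|` by the weighted norm with a constant independent of `x`
(`setLIntegral_openCube_gradient_le`). Integrating along segments from `x` and rescaling leaves the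
factor `t ^ (-D/p)`, integrable on `(0,1)` because `D < p` (`setLIntegral_openCube_abs_sub_le`).

For the Hölder bound, the cubes at `x` and `y` share a subcube of side `|x - y|`, over which one
averages. For the sup bound, a subcube outside `Ω` plays this role, since `u` vanishes there.
Finally `n ≤ D`, so only finitely many dimensions contribute to `C`. -/

/-! ### Hölder's inequality, scaling and segment integrals -/

/-- The open cube `(0, s)ⁿ`. -/
def openCube (n : ℕ) (s : ℝ) : Set (Fin n → ℝ) :=
  univ.pi fun _ => Ioo 0 s

lemma measurableSet_openCube (n : ℕ) (s : ℝ) : MeasurableSet (openCube n s) :=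
  MeasurableSet.univ_pi fun _ => measurableSet_Ioo

lemma volume_openCube (n : ℕ) {s : ℝ} (hs : 0 ≤ s) :
    volume (openCube n s) = ENNReal.ofReal (s ^ n) := by
  simp [openCube, volume_pi_pi, ENNReal.ofReal_pow hs]

lemma mem_openCube {n : ℕ} {s : ℝ} {w : Fin n → ℝ} :
    w ∈ openCube n s ↔ ∀ i, 0 < w i ∧ w i < s := by
  simp [openCube]

lemma setLIntegral_openCube_prod_rpow_le {n : ℕ} (b : Fin n → ℝ) {κ s : ℝ} (hκ : 0 < κ)
    (hb : ∀ i, κ ≤ 1 - b i) (hs : 0 < s) :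
    ∫⁻ w in openCube n s, ENNReal.ofReal (∏ i, w i ^ (-b i)) ≤
      ENNReal.ofReal (κ⁻¹ ^ n * s ^ (n - ∑ i, b i)) := by
  have hInt : ∀ i, Integrable (fun t : ℝ => t ^ (-b i)) (volume.restrict (Ioo 0 s)) := fun i => by
    have := intervalIntegral.intervalIntegrable_rpow' (a := 0) (b := s) (r := -b i)
      (by linarith [hb i])
    rw [intervalIntegrable_iff_integrableOn_Ioo_of_le hs.le] at this
    exact this
  have hval : ∀ i, ∫ t in Ioo 0 s, t ^ (-b i) = s ^ (1 - b i) / (1 - b i) := fun i => by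
    have h1 := hb i
    rw [← integral_Ioc_eq_integral_Ioo, ← intervalIntegral.integral_of_le hs.le,
      integral_rpow (Or.inl (by linarith)), Real.zero_rpow (by linarith), sub_zero,
      neg_add_eq_sub]
  have hae : ∀ᵐ w ∂(volume.restrict (openCube n s)), 0 ≤ ∏ i, w i ^ (-b i) := by
    refine ae_restrict_of_forall_mem (measurableSet_openCube n s) fun w hw => ?_
    exact Finset.prod_nonneg fun i _ => Real.rpow_nonneg (mem_openCube.1 hw i).1.le _
  have hres : (volume : Measure (Fin n → ℝ)).restrict (openCube n s) =
      Measure.pi fun _ => volume.restrict (Ioo 0 s) := by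
    rw [volume_pi, openCube, Measure.restrict_pi_pi]
  rw [hres] at hae ⊢
  rw [← ofReal_integral_eq_lintegral_ofReal (Integrable.fintype_prod hInt) hae,
    integral_fintype_prod_eq_prod (f := fun i (t : ℝ) => t ^ (-b i))]
  apply ENNReal.ofReal_le_ofReal
  simp_rw [hval]
  have hle : ∀ i, s ^ (1 - b i) / (1 - b i) ≤ κ⁻¹ * s ^ (1 - b i) := fun i => by
    rw [div_eq_inv_mul]
    have := hb i
    gcongr
  calc ∏ i, s ^ (1 - b i) / (1 - b i) ≤ ∏ i, κ⁻¹ * s ^ (1 - b i) :=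
        Finset.prod_le_prod (fun i _ => by have := hb i; have : 0 < 1 - b i := by linarith
                                           positivity) fun i _ => hle i
    _ = κ⁻¹ ^ n * s ^ (n - ∑ i, b i) := by
        rw [Finset.prod_mul_distrib, ← Real.rpow_sum_of_pos hs]
        simp

/-- Hölder's inequality for the splitting `1 = w^(A/p) * w^(-A/p)`. The dual factor is the integral
of `w^(-A/(p-1))`, finite because `A i ≤ D - n ≤ D - 1 < p - 1`; the same chain gives the uniform
gap `(p - D)/(p - 1)`. -/
lemma setLIntegral_openCube_le_weighted {n : ℕ} {p D : ℝ} (hn : 1 ≤ n) (hp : D < p)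
    (A : Fin n → ℝ) (hA : ∀ i, 0 ≤ A i) (hD : D = (∑ i, A i) + n) {s : ℝ} (hs : 0 < s)
    {G : (Fin n → ℝ) → ℝ≥0∞} (hG : Measurable G) :
    ∫⁻ w in openCube n s, G w ≤
      (∫⁻ w in openCube n s, ENNReal.ofReal (∏ i, w i ^ A i) * G w ^ p) ^ (1 / p) *
        ENNReal.ofReal ((((p - 1) / (p - D)) ^ n) ^ ((p - 1) / p) * s ^ (n - D / p)) := by
  have hn' : (1 : ℝ) ≤ n := by exact_mod_cast hn
  have hsum : 0 ≤ ∑ i, A i := Finset.sum_nonneg fun i _ => hA i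
  have hp1 : 1 < p := by linarith
  have hp0 : 0 < p := by linarith
  have hq : p.HolderConjugate (p / (p - 1)) := Real.HolderConjugate.conjExponent hp1
  have hmeas : ∀ c : ℝ, Measurable fun w : Fin n → ℝ =>
      ENNReal.ofReal (∏ i, w i ^ (A i * c)) := fun c => by
    refine ENNReal.measurable_ofReal.comp ?_
    exact Finset.measurable_prod _ fun i _ => (measurable_pi_apply i).pow_const _
  have hsplit : ∫⁻ w in openCube n s, G w = ∫⁻ w in openCube n s,
      ((fun w : Fin n → ℝ => ENNReal.ofReal (∏ i, w i ^ (A i * (1 / p))) * G w) *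
        fun w : Fin n → ℝ => ENNReal.ofReal (∏ i, w i ^ (A i * (-(1 / p))))) w := by
    refine setLIntegral_congr_fun (measurableSet_openCube n s) fun w hw => ?_
    have hw := fun i => (mem_openCube.1 hw i).1
    simp only [Pi.mul_apply]
    rw [mul_right_comm, ← ENNReal.ofReal_mul
      (Finset.prod_nonneg fun i _ => Real.rpow_nonneg (hw i).le _), ← Finset.prod_mul_distrib,
      Finset.prod_eq_one, ENNReal.ofReal_one, one_mul]
    intro i _
    rw [← Real.rpow_add (hw i)]
    simp
  rw [hsplit]
  refine (ENNReal.lintegral_mul_le_Lp_mul_Lq _ hq ((hmeas _).mul hG).aemeasurable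
    (hmeas _).aemeasurable).trans ?_
  gcongr ?_ ^ (1 / p) * ?_
  · refine setLIntegral_mono' (measurableSet_openCube n s) fun w hw => ?_
    have hw := fun i => (mem_openCube.1 hw i).1
    rw [Pi.mul_apply, ENNReal.mul_rpow_of_nonneg _ _ hp0.le, ENNReal.ofReal_rpow_of_nonneg
      (Finset.prod_nonneg fun i _ => Real.rpow_nonneg (hw i).le _) hp0.le,
      ← Real.finsetProd_rpow _ _ fun i _ => Real.rpow_nonneg (hw i).le _]
    refine le_of_eq (congrArg (fun c => ENNReal.ofReal c * G w ^ p)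
      (Finset.prod_congr rfl fun i _ => ?_))
    rw [← Real.rpow_mul (hw i).le]
    congr 1
    field_simp
  · have hκ : 0 < (p - D) / (p - 1) := div_pos (by linarith) (by linarith)
    have hp1' : 0 < p - 1 := by linarith
    have hbox := setLIntegral_openCube_prod_rpow_le (fun i => A i / (p - 1)) hκ (fun i => by
      have : A i ≤ ∑ j, A j := Finset.single_le_sum (fun j _ => hA j) (Finset.mem_univ i)
      rw [one_sub_div hp1'.ne']
      exact div_le_div_of_nonneg_right (by linarith) hp1'.le) hs
    have hle : ∫⁻ w in openCube n s,
        ENNReal.ofReal (∏ i, w i ^ (A i * (-(1 / p)))) ^ (p / (p - 1)) ≤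
        ENNReal.ofReal (((p - 1) / (p - D)) ^ n * s ^ (n - (∑ i, A i) / (p - 1))) := by
      rw [← inv_div (p - D), Finset.sum_div]
      refine le_trans (le_of_eq ?_) hbox
      refine setLIntegral_congr_fun (measurableSet_openCube n s) fun w hw => ?_
      have hw := fun i => (mem_openCube.1 hw i).1
      rw [ENNReal.ofReal_rpow_of_nonneg
        (Finset.prod_nonneg fun i _ => Real.rpow_nonneg (hw i).le _) (by positivity),
        ← Real.finsetProd_rpow _ _ fun i _ => Real.rpow_nonneg (hw i).le _]
      congr 1
      refine Finset.prod_congr rfl fun i _ => ?_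
      rw [← Real.rpow_mul (hw i).le]
      congr 1
      field_simp
    have hpD : 0 < p - D := by linarith
    calc _ ≤ ENNReal.ofReal (((p - 1) / (p - D)) ^ n * s ^ (n - (∑ i, A i) / (p - 1))) ^
          (1 / (p / (p - 1))) := ENNReal.rpow_le_rpow hle (by positivity)
      _ = _ := by
        rw [ENNReal.ofReal_rpow_of_nonneg (by positivity) (by positivity), one_div_div,
          Real.mul_rpow (by positivity) (by positivity), ← Real.rpow_mul hs.le]
        congr 3
        rw [hD]
        field_simp
        ring

lemma setLIntegral_openCube_comp_smul {n : ℕ} {t : ℝ} (ht : 0 < t) (R : ℝ)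
    {G : (Fin n → ℝ) → ℝ≥0∞} (hG : Measurable G) :
    ∫⁻ w in openCube n R, G (t • w) =
      ENNReal.ofReal ((t ^ n)⁻¹) * ∫⁻ w in openCube n (t * R), G w := by
  have hpre : (fun w : Fin n → ℝ => t • w) ⁻¹' openCube n (t * R) = openCube n R := by
    ext w
    simp [mem_openCube, ht]
  have hm : Measurable fun w : Fin n → ℝ => t • w := measurable_const_smul t
  have h := setLIntegral_map (μ := volume) (measurableSet_openCube n (t * R)) hG hm
  rw [hpre] at h
  rw [← h, Measure.map_addHaar_smul _ ht.ne', Measure.restrict_smul, lintegral_smul_measure]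
  simp [abs_of_pos ht]

lemma ofReal_abs_sub_le_setLIntegral_gradient {E : Type*} [NormedAddCommGroup E]
    [InnerProductSpace ℝ E] [CompleteSpace E] {u : E → ℝ} (hu : ContDiff ℝ 1 u) (x v : E) :
    ENNReal.ofReal |u (x + v) - u x| ≤
      ∫⁻ t in Ioo (0 : ℝ) 1, ENNReal.ofReal (‖v‖ * ‖gradient u (x + t • v)‖) := by
  have hderiv : ∀ t : ℝ, HasDerivAt (fun t : ℝ => u (x + t • v)) (fderiv ℝ u (x + t • v) v) t :=
    fun t => by
      have h1 : HasDerivAt (fun t : ℝ => x + t • v) v t := by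
        simpa using ((hasDerivAt_id t).smul_const v).const_add x
      exact ((hu.differentiable one_ne_zero _).hasFDerivAt).comp_hasDerivAt t h1
  have hcont : Continuous fun t : ℝ => fderiv ℝ u (x + t • v) v :=
    ((hu.continuous_fderiv one_ne_zero).comp (by fun_prop)).clm_apply continuous_const
  have hftc := intervalIntegral.integral_eq_sub_of_hasDerivAt (a := 0) (b := 1)
    (fun t _ => hderiv t) (hcont.intervalIntegrable 0 1)
  simp only [one_smul, zero_smul, add_zero] at hftc
  rw [← hftc, intervalIntegral.integral_of_le zero_le_one, integral_Ioc_eq_integral_Ioo,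
    ← Real.enorm_eq_ofReal_abs]
  refine (enorm_integral_le_lintegral_enorm _).trans (lintegral_mono fun t => ?_)
  rw [← ofReal_norm]
  apply ENNReal.ofReal_le_ofReal
  rw [← inner_gradient_left, mul_comm]
  exact norm_inner_le_norm _ _
-- Orthants with vertex `x`
/-- The affine map `w ↦ x + (σ₁ w₁, …, σₙ wₙ)`, which for signs `σᵢ` carries the positive orthant
to an orthant with vertex `x`. -/
noncomputable def orthantMap {n : ℕ} (x : EuclideanSpace ℝ (Fin n)) (σ : Fin n → ℝ)
    (w : Fin n → ℝ) : EuclideanSpace ℝ (Fin n) :=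
  WithLp.toLp 2 fun i => x i + σ i * w i

section orthantMap

variable {n : ℕ} (x : EuclideanSpace ℝ (Fin n)) {σ : Fin n → ℝ}

@[simp]
lemma orthantMap_apply (w : Fin n → ℝ) (i : Fin n) : orthantMap x σ w i = x i + σ i * w i := rfl

lemma orthantMap_smul (t : ℝ) (w : Fin n → ℝ) :
    orthantMap x σ (t • w) = x + t • (orthantMap x σ w - x) := by
  ext i
  simp
  ring

lemma continuous_orthantMap : Continuous (orthantMap x σ) := by
  unfold orthantMap
  fun_prop

lemma measurePreserving_orthantMap (hσ : ∀ i, |σ i| = 1) :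
    MeasurePreserving (orthantMap x σ) := by
  refine (PiLp.volume_preserving_toLp (Fin n)).comp
    (volume_preserving_pi (f := fun i t => x i + σ i * t) fun i => ?_)
  refine (measurePreserving_add_left volume (x i)).comp ⟨measurable_const_mul _, ?_⟩
  have h0 : σ i ≠ 0 := fun h => by simpa [h] using hσ i
  rw [Real.map_volume_mul_left h0, abs_inv, hσ i]
  simp

lemma norm_orthantMap_sub_le (hσ : ∀ i, |σ i| = 1) {R : ℝ} (hR : 0 ≤ R) {w : Fin n → ℝ}
    (hw : ∀ i, |w i| ≤ R) : ‖orthantMap x σ w - x‖ ≤ √n * R := by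
  rw [EuclideanSpace.norm_eq]
  calc √(∑ i, ‖(orthantMap x σ w - x) i‖ ^ 2) ≤ √(∑ _i : Fin n, R ^ 2) := by
        gcongr with i
        simpa [abs_mul, hσ i] using hw i
    _ = √n * R := by simp [Real.sqrt_sq hR]

/-- Moving away from the hyperplane only increases the weight: `|x i + σ i * w i| = σ i * x i + w i
≥ w i` whenever `A i > 0`. -/
lemma prod_rpow_le_monomialWeight_orthantMap (hσ : ∀ i, |σ i| = 1) {A : Fin n → ℝ}
    (hA : ∀ i, 0 ≤ A i) (hx : ∀ i, 0 < A i → 0 ≤ σ i * x i) {w : Fin n → ℝ}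
    (hw : ∀ i, 0 ≤ w i) : ∏ i, w i ^ A i ≤ monomialWeight A (orthantMap x σ w) := by
  refine Finset.prod_le_prod (fun i _ => Real.rpow_nonneg (hw i) _) fun i _ => ?_
  rcases (hA i).eq_or_lt with h | h
  · simp [← h]
  · refine Real.rpow_le_rpow (hw i) ?_ h.le
    have hsq : σ i * σ i = 1 := by rw [← abs_mul_abs_self, hσ i, one_mul]
    calc w i ≤ σ i * x i + w i := le_add_of_nonneg_left (hx i h)
      _ = σ i * orthantMap x σ w i := by
        rw [orthantMap_apply, mul_add, ← mul_assoc, hsq, one_mul]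
      _ ≤ |σ i * orthantMap x σ w i| := le_abs_self _
      _ = |orthantMap x σ w i| := by rw [abs_mul, hσ i, one_mul]

end orthantMap

/-! ### The weighted gradient norm -/

section weightedGradNorm

variable {n : ℕ} {A : Fin n → ℝ} {p : ℝ} {u : EuclideanSpace ℝ (Fin n) → ℝ}

lemma continuous_gradient_of_contDiff {E : Type*} [NormedAddCommGroup E]
    [InnerProductSpace ℝ E] [CompleteSpace E] {u : E → ℝ} (hu : ContDiff ℝ 1 u) :
    Continuous (gradient u) :=
  (InnerProductSpace.toDual ℝ E).symm.continuous.comp (hu.continuous_fderiv one_ne_zero)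

lemma gradient_eq_zero_of_notMem_tsupport {E : Type*} [NormedAddCommGroup E]
    [InnerProductSpace ℝ E] [CompleteSpace E] {u : E → ℝ} {x : E} (hx : x ∉ tsupport u) :
    gradient u x = 0 := by
  have : fderiv ℝ u x = 0 := by
    by_contra h
    exact hx (support_fderiv_subset ℝ h)
  simp [gradient, this]

lemma monomialWeight_nonneg (A : Fin n → ℝ) (x : EuclideanSpace ℝ (Fin n)) :
    0 ≤ monomialWeight A x :=
  Finset.prod_nonneg fun _ _ => Real.rpow_nonneg (abs_nonneg _) _

lemma continuous_monomialWeight (hA : ∀ i, 0 ≤ A i) : Continuous (monomialWeight A) := by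
  unfold monomialWeight
  refine continuous_finsetProd _ fun i _ => Continuous.rpow_const ?_ fun x => Or.inr (hA i)
  fun_prop

lemma continuous_weighted_gradient (hA : ∀ i, 0 ≤ A i) (hp : 0 < p) (hu : ContDiff ℝ 1 u) :
    Continuous fun x => monomialWeight A x * ‖gradient u x‖ ^ p :=
  (continuous_monomialWeight hA).mul
    ((continuous_gradient_of_contDiff hu).norm.rpow_const fun _ => Or.inr hp.le)

lemma integrable_weighted_gradient (hA : ∀ i, 0 ≤ A i) (hp : 0 < p) (hu : ContDiff ℝ 1 u)
    (hc : HasCompactSupport u) :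
    Integrable fun x => monomialWeight A x * ‖gradient u x‖ ^ p := by
  refine (continuous_weighted_gradient hA hp hu).integrable_of_hasCompactSupport ?_
  refine HasCompactSupport.intro hc fun x hx => ?_
  rw [gradient_eq_zero_of_notMem_tsupport hx, norm_zero, Real.zero_rpow hp.ne', mul_zero]

/-- Compact support makes the integrand integrable, so the Bochner integral does not take its
default value `0`. -/
lemma ofReal_weightedGradNorm (hA : ∀ i, 0 ≤ A i) (hp : 0 < p) (hu : ContDiff ℝ 1 u)
    (hc : HasCompactSupport u) (S : Set (EuclideanSpace ℝ (Fin n))) :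
    ENNReal.ofReal (weightedGradNorm A p S u) =
      (∫⁻ x in S, ENNReal.ofReal (monomialWeight A x * ‖gradient u x‖ ^ p)) ^ (1 / p) := by
  have hnn : ∀ x, 0 ≤ monomialWeight A x * ‖gradient u x‖ ^ p := fun x =>
    mul_nonneg (monomialWeight_nonneg A x) (Real.rpow_nonneg (norm_nonneg _) _)
  rw [weightedGradNorm, ← ofReal_integral_eq_lintegral_ofReal
    (integrable_weighted_gradient hA hp hu hc).integrableOn (Filter.Eventually.of_forall hnn),
    ENNReal.ofReal_rpow_of_nonneg (integral_nonneg hnn) (by positivity)]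

lemma weightedGradNorm_nonneg (A : Fin n → ℝ) (p : ℝ) (S : Set (EuclideanSpace ℝ (Fin n)))
    (u : EuclideanSpace ℝ (Fin n) → ℝ) : 0 ≤ weightedGradNorm A p S u :=
  Real.rpow_nonneg (integral_nonneg fun x =>
    mul_nonneg (monomialWeight_nonneg A x) (Real.rpow_nonneg (norm_nonneg _) _)) _

lemma weightedGradNorm_univ_eq (hp : 0 < p) {Ω : Set (EuclideanSpace ℝ (Fin n))}
    (hΩ : tsupport u ⊆ Ω) : weightedGradNorm A p univ u = weightedGradNorm A p Ω u := by
  rw [weightedGradNorm, weightedGradNorm, setIntegral_univ,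
    setIntegral_eq_integral_of_forall_compl_eq_zero]
  intro x hx
  rw [gradient_eq_zero_of_notMem_tsupport fun h => hx (hΩ h), norm_zero,
    Real.zero_rpow hp.ne', mul_zero]

end weightedGradNorm

/-! ### Morrey's estimate on cubes -/

/-- The constant of the Morrey estimate on cubes in dimension `n`. -/
noncomputable def morreyConst (p D : ℝ) (n : ℕ) : ℝ :=
  √n * (((p - 1) / (p - D)) ^ n) ^ ((p - 1) / p) / (1 - D / p)

section morrey

variable {n : ℕ} {p D : ℝ} {A : Fin n → ℝ} {u : EuclideanSpace ℝ (Fin n) → ℝ}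
  {x : EuclideanSpace ℝ (Fin n)} {σ : Fin n → ℝ} {S : Set (EuclideanSpace ℝ (Fin n))}

lemma setLIntegral_openCube_gradient_le (hn : 1 ≤ n) (hp : D < p)
    (hA : ∀ i, 0 ≤ A i) (hD : D = (∑ i, A i) + n) (hu : ContDiff ℝ 1 u)
    (hc : HasCompactSupport u) (hσ : ∀ i, |σ i| = 1) (hx : ∀ i, 0 < A i → 0 ≤ σ i * x i)
    (hS : MeasurableSet S) (hxS : ∀ w : Fin n → ℝ, (∀ i, 0 < w i) → orthantMap x σ w ∈ S)
    {s : ℝ} (hs : 0 < s) :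
    ∫⁻ w in openCube n s, ENNReal.ofReal ‖gradient u (orthantMap x σ w)‖ ≤
      ENNReal.ofReal (weightedGradNorm A p S u) *
        ENNReal.ofReal ((((p - 1) / (p - D)) ^ n) ^ ((p - 1) / p) * s ^ (n - D / p)) := by
  have hn' : (1 : ℝ) ≤ n := by exact_mod_cast hn
  have hp0 : 0 < p := by linarith [Finset.sum_nonneg fun i (_ : i ∈ Finset.univ) => hA i]
  have hG : Measurable fun w => ENNReal.ofReal ‖gradient u (orthantMap x σ w)‖ :=
    (ENNReal.measurable_ofReal.comp ((continuous_gradient_of_contDiff hu).comp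
      (continuous_orthantMap x)).norm.measurable)
  refine (setLIntegral_openCube_le_weighted hn hp A hA hD hs hG).trans ?_
  gcongr
  rw [ofReal_weightedGradNorm hA hp0 hu hc]
  gcongr
  have hmeas : Measurable fun y => ENNReal.ofReal (monomialWeight A y * ‖gradient u y‖ ^ p) :=
    ENNReal.measurable_ofReal.comp (continuous_weighted_gradient hA hp0 hu).measurable
  rw [← (measurePreserving_orthantMap x hσ).setLIntegral_comp_preimage hS hmeas]
  refine le_trans (setLIntegral_mono' (measurableSet_openCube n s) fun w hw => ?_)
    (lintegral_mono_set (s := openCube n s) fun w hw => hxS w fun i => (mem_openCube.1 hw i).1)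
  have hw := fun i => (mem_openCube.1 hw i).1
  rw [ENNReal.ofReal_mul (monomialWeight_nonneg _ _),
    ENNReal.ofReal_rpow_of_nonneg (norm_nonneg _) hp0.le]
  gcongr
  exact prod_rpow_le_monomialWeight_orthantMap x hσ hA hx fun i => (hw i).le

/-- Morrey's estimate on a cube with a vertex at `x` which points away from the coordinate
hyperplanes on which the weight vanishes. -/
lemma setLIntegral_openCube_abs_sub_le (hn : 1 ≤ n) (hp : D < p)
    (hA : ∀ i, 0 ≤ A i) (hD : D = (∑ i, A i) + n) (hu : ContDiff ℝ 1 u)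
    (hc : HasCompactSupport u) (hσ : ∀ i, |σ i| = 1) (hx : ∀ i, 0 < A i → 0 ≤ σ i * x i)
    (hS : MeasurableSet S) (hxS : ∀ w : Fin n → ℝ, (∀ i, 0 < w i) → orthantMap x σ w ∈ S)
    {R : ℝ} (hR : 0 < R) :
    ∫⁻ w in openCube n R, ENNReal.ofReal |u (orthantMap x σ w) - u x| ≤
      ENNReal.ofReal (morreyConst p D n * R ^ (n + (1 - D / p)) *
        weightedGradNorm A p S u) := by
  have hn' : (1 : ℝ) ≤ n := by exact_mod_cast hn
  have hD1 : 1 ≤ D := by linarith [Finset.sum_nonneg fun i (_ : i ∈ Finset.univ) => hA i]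
  have hp0 : 0 < p := by linarith
  have hα : 0 < 1 - D / p := by rw [sub_pos, div_lt_one hp0]; exact hp
  set N := weightedGradNorm A p S u with hN
  have hN0 : 0 ≤ N := weightedGradNorm_nonneg A p S u
  set K := (((p - 1) / (p - D)) ^ n) ^ ((p - 1) / p) with hK
  have hK0 : 0 ≤ K := by
    have : 0 ≤ (p - 1) / (p - D) := div_nonneg (by linarith) (by linarith)
    positivity
  have hcg := (continuous_gradient_of_contDiff hu).norm
  have hG : Measurable fun w => ENNReal.ofReal ‖gradient u (orthantMap x σ w)‖ :=
    (ENNReal.measurable_ofReal.comp (hcg.comp (continuous_orthantMap x)).measurable)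
  calc ∫⁻ w in openCube n R, ENNReal.ofReal |u (orthantMap x σ w) - u x|
      ≤ ∫⁻ w in openCube n R, ∫⁻ t in Ioo (0 : ℝ) 1,
          ENNReal.ofReal (√n * R) * ENNReal.ofReal ‖gradient u (orthantMap x σ (t • w))‖ := by
        refine setLIntegral_mono' (measurableSet_openCube n R) fun w hw => ?_
        have h := ofReal_abs_sub_le_setLIntegral_gradient hu x (orthantMap x σ w - x)
        rw [add_sub_cancel] at h
        refine h.trans (lintegral_mono fun t => ?_)
        rw [← ENNReal.ofReal_mul (by positivity), orthantMap_smul]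
        gcongr
        refine norm_orthantMap_sub_le x hσ hR.le fun i => ?_
        have := mem_openCube.1 hw i
        rw [abs_of_pos this.1]
        exact this.2.le
    _ = ∫⁻ t in Ioo (0 : ℝ) 1, ∫⁻ w in openCube n R,
          ENNReal.ofReal (√n * R) * ENNReal.ofReal ‖gradient u (orthantMap x σ (t • w))‖ := by
        refine lintegral_lintegral_swap (Measurable.aemeasurable ?_)
        refine Measurable.const_mul (ENNReal.measurable_ofReal.comp
          (hcg.comp ((continuous_orthantMap x).comp ?_)).measurable) _
        fun_prop
    -- The dilation by `t` costs `t ^ (-n)` and the cube of side `t * R` gives `(t * R) ^ (n -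
    -- D/p)`; together they leave `t ^ (-D/p)`.
    _ ≤ ∫⁻ t in Ioo (0 : ℝ) 1, ENNReal.ofReal (√n * K * R ^ (n + (1 - D / p)) * N) *
          ENNReal.ofReal (t ^ (-(D / p))) := by
        refine setLIntegral_mono' measurableSet_Ioo fun t ht => ?_
        have ht0 : 0 < t := ht.1
        rw [lintegral_const_mul' _ _ ENNReal.ofReal_ne_top,
          setLIntegral_openCube_comp_smul ht0 R hG]
        refine (mul_le_mul_right (mul_le_mul_right (setLIntegral_openCube_gradient_le hn hp hA hD
          hu hc hσ hx hS hxS (mul_pos ht0 hR)) _) _).trans (le_of_eq ?_)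
        rw [← ENNReal.ofReal_mul hN0, ← ENNReal.ofReal_mul (by positivity),
          ← ENNReal.ofReal_mul (by positivity), ← ENNReal.ofReal_mul (by positivity)]
        congr 1
        rw [Real.mul_rpow ht0.le hR.le, show (n : ℝ) + (1 - D / p) = 1 + (n - D / p) by ring,
          Real.rpow_add hR, Real.rpow_one, show (n : ℝ) - D / p = n + -(D / p) by ring,
          Real.rpow_add ht0, Real.rpow_natCast, ← hK]
        field_simp
    _ = ENNReal.ofReal (morreyConst p D n * R ^ (n + (1 - D / p)) * N) := by
        have hr : -1 < -(D / p) := by linarith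
        have hInt := intervalIntegral.intervalIntegrable_rpow' (a := 0) (b := 1) hr
        rw [intervalIntegrable_iff_integrableOn_Ioo_of_le zero_le_one] at hInt
        rw [lintegral_const_mul' _ _ ENNReal.ofReal_ne_top,
          ← ofReal_integral_eq_lintegral_ofReal hInt
            (ae_restrict_of_forall_mem measurableSet_Ioo fun t ht => Real.rpow_nonneg ht.1.le _),
          ← integral_Ioc_eq_integral_Ioo, ← intervalIntegral.integral_of_le zero_le_one,
          integral_rpow (Or.inl hr), Real.zero_rpow (by linarith), Real.one_rpow, sub_zero,
          neg_add_eq_sub, ← ENNReal.ofReal_mul (by positivity), morreyConst, ← hK]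
        congr 1
        ring

/-- The displaced cube `e + (0, r)ⁿ` lies in `(0, 2r)ⁿ`. The freedom in `e` serves both the common
subcube of two points and the subcube outside a domain. -/
lemma setLIntegral_openCube_abs_sub_add_le (hn : 1 ≤ n) (hp : D < p)
    (hA : ∀ i, 0 ≤ A i) (hD : D = (∑ i, A i) + n) (hu : ContDiff ℝ 1 u)
    (hc : HasCompactSupport u) (hσ : ∀ i, |σ i| = 1) (hx : ∀ i, 0 < A i → 0 ≤ σ i * x i)
    (hS : MeasurableSet S) (hxS : ∀ w : Fin n → ℝ, (∀ i, 0 < w i) → orthantMap x σ w ∈ S)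
    {r : ℝ} (hr : 0 < r) {e : Fin n → ℝ} (he : ∀ i, e i ∈ Icc 0 r) :
    ∫⁻ w in openCube n r, ENNReal.ofReal |u (orthantMap x σ (e + w)) - u x| ≤
      ENNReal.ofReal (morreyConst p D n * (2 * r) ^ (n + (1 - D / p)) *
        weightedGradNorm A p S u) := by
  refine le_trans ?_ (setLIntegral_openCube_abs_sub_le hn hp hA hD hu hc hσ hx hS hxS
    (mul_pos two_pos hr))
  have hmeas : Measurable fun w => ENNReal.ofReal |u (orthantMap x σ w) - u x| :=
    ENNReal.measurable_ofReal.comp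
      ((hu.continuous.comp (continuous_orthantMap x)).sub continuous_const).abs.measurable
  rw [← (measurePreserving_add_left volume e).setLIntegral_comp_preimage
    (measurableSet_openCube n (2 * r)) hmeas]
  refine lintegral_mono_set fun w hw => mem_openCube.2 fun i => ?_
  have h1 := mem_openCube.1 hw i
  have h2 := he i
  simp only [mem_Icc, Pi.add_apply] at h2 ⊢
  constructor <;> linarith

end morrey
-- Pointwise bounds and the choice of constant
lemma morreyConst_nonneg {p D : ℝ} (hD : 1 ≤ D) (hp : D < p) (n : ℕ) : 0 ≤ morreyConst p D n := by
  have h1 : 0 ≤ 1 - D / p := by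
    rw [sub_nonneg, div_le_one (by linarith)]
    exact hp.le
  have h2 : 0 ≤ (p - 1) / (p - D) := div_nonneg (by linarith) (by linarith)
  rw [morreyConst]
  positivity

lemma measurableSet_starSpace {n : ℕ} (A : Fin n → ℝ) : MeasurableSet (starSpace A) := by
  have : starSpace A = ⋂ i, ⋂ (_ : 0 < A i), {x | 0 < x i} := by
    ext x
    simp [starSpace]
  rw [this]
  refine MeasurableSet.iInter fun i => MeasurableSet.iInter fun _ => ?_
  exact (isOpen_lt continuous_const (by fun_prop)).measurableSet

/-- The constant of the weighted Morrey inequality in dimension `n`. -/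
noncomputable def holderConst (p D : ℝ) (n : ℕ) : ℝ :=
  2 * (morreyConst p D n * 2 ^ (n + (1 - D / p)))

section

variable {n : ℕ} {p D : ℝ} {A : Fin n → ℝ} {u : EuclideanSpace ℝ (Fin n) → ℝ}

lemma abs_sub_le_holderConst (hn : 1 ≤ n) (hp : D < p) (hA : ∀ i, 0 ≤ A i)
    (hD : D = (∑ i, A i) + n) (hu : ContDiff ℝ 1 u) (hc : HasCompactSupport u)
    {x y : EuclideanSpace ℝ (Fin n)} (hx : x ∈ starSpace A) (hy : y ∈ starSpace A)
    (hxy : x ≠ y) :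
    |u x - u y| ≤ holderConst p D n * ‖x - y‖ ^ (1 - D / p) *
      weightedGradNorm A p (starSpace A) u := by
  have hn' : (1 : ℝ) ≤ n := by exact_mod_cast hn
  have hD1 : 1 ≤ D := by linarith [Finset.sum_nonneg fun i (_ : i ∈ Finset.univ) => hA i]
  have hM := morreyConst_nonneg hD1 hp n
  set N := weightedGradNorm A p (starSpace A) u
  have hN : 0 ≤ N := weightedGradNorm_nonneg A p (starSpace A) u
  set r := ‖x - y‖
  have hr : 0 < r := norm_pos_iff.2 (sub_ne_zero.2 hxy)
  have hcoord : ∀ i, |x i - y i| ≤ r := fun i => by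
    simpa using PiLp.norm_apply_le (x - y) i
  -- The common subcube has the coordinatewise maximum of `x` and `y` as its lowest vertex, so it is
  -- a nonnegative displacement of at most `r` from each point.
  have key : ∀ z ∈ starSpace A, (∀ i, max (x i) (y i) - z i ∈ Icc 0 r) →
      ∫⁻ w in openCube n r,
        ENNReal.ofReal |u (WithLp.toLp 2 fun i => max (x i) (y i) + w i) - u z| ≤
        ENNReal.ofReal (morreyConst p D n * (2 * r) ^ (n + (1 - D / p)) * N) := by
    intro z hz hze
    convert setLIntegral_openCube_abs_sub_add_le (σ := fun _ => 1) (x := z) hn hp hA hD hu hc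
      (fun _ => abs_one) (fun i hi => by simpa using (hz i hi).le) (measurableSet_starSpace A)
      (fun w hw i hi => ?_) hr hze using 6 with w
    · congr 1
      ext i
      simp only [orthantMap_apply, Pi.add_apply]
      ring
    · have := hz i hi
      have := hw i
      simp only [orthantMap_apply]
      positivity
  have hkx := key x hx fun i => by
    have := abs_le.1 (hcoord i)
    constructor
    · simp
    · rw [sub_le_iff_le_add]
      exact max_le (by linarith) (by linarith)
  have hky := key y hy fun i => by
    have := abs_le.1 (hcoord i)
    constructor
    · simp
    · rw [sub_le_iff_le_add]
      exact max_le (by linarith) (by linarith)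
  have hmeas : Measurable fun w : Fin n → ℝ =>
      ENNReal.ofReal |u (WithLp.toLp 2 fun i => max (x i) (y i) + w i) - u x| := by
    refine ENNReal.measurable_ofReal.comp (Continuous.measurable ?_)
    exact ((hu.continuous.comp (by fun_prop)).sub continuous_const).abs
  have hmain : ENNReal.ofReal (|u x - u y| * r ^ n) ≤
      ENNReal.ofReal (2 * (morreyConst p D n * (2 * r) ^ (n + (1 - D / p)) * N)) := by
    calc ENNReal.ofReal (|u x - u y| * r ^ n)
        = ∫⁻ _ in openCube n r, ENNReal.ofReal |u x - u y| := by
          rw [setLIntegral_const, volume_openCube n hr.le, ENNReal.ofReal_mul (abs_nonneg _)]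
      _ ≤ ∫⁻ w in openCube n r,
          (ENNReal.ofReal |u (WithLp.toLp 2 fun i => max (x i) (y i) + w i) - u x| +
            ENNReal.ofReal |u (WithLp.toLp 2 fun i => max (x i) (y i) + w i) - u y|) := by
          refine lintegral_mono fun w => ?_
          rw [← ENNReal.ofReal_add (abs_nonneg _) (abs_nonneg _)]
          apply ENNReal.ofReal_le_ofReal
          rw [abs_sub_comm _ (u x)]
          exact abs_sub_le _ _ _
      _ ≤ _ := by
          rw [lintegral_add_left hmeas, two_mul,
            ENNReal.ofReal_add (by positivity) (by positivity)]
          exact add_le_add hkx hky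
  rw [ENNReal.ofReal_le_ofReal_iff (by positivity), Real.mul_rpow two_pos.le hr.le,
    Real.rpow_add hr, Real.rpow_natCast] at hmain
  refine le_of_mul_le_mul_right (hmain.trans (le_of_eq ?_)) (pow_pos hr n)
  rw [holderConst]
  ring

lemma abs_le_holderConst_mul_diam (hn : 1 ≤ n) (hp : D < p) (hA : ∀ i, 0 ≤ A i)
    (hD : D = (∑ i, A i) + n) (hu : ContDiff ℝ 1 u) (hc : HasCompactSupport u)
    {Ω : Set (EuclideanSpace ℝ (Fin n))} (hΩ : IsOpen Ω) (hb : Bornology.IsBounded Ω)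
    (hs : tsupport u ⊆ Ω) {x : EuclideanSpace ℝ (Fin n)} (hx : x ∈ Ω) :
    |u x| ≤ holderConst p D n * Metric.diam Ω ^ (1 - D / p) * weightedGradNorm A p Ω u := by
  have hn' : (1 : ℝ) ≤ n := by exact_mod_cast hn
  have hD1 : 1 ≤ D := by linarith [Finset.sum_nonneg fun i (_ : i ∈ Finset.univ) => hA i]
  have hM := morreyConst_nonneg hD1 hp n
  rw [← weightedGradNorm_univ_eq (by linarith) hs]
  set N := weightedGradNorm A p univ u
  have hN : 0 ≤ N := weightedGradNorm_nonneg A p univ u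
  have i₀ : Fin n := ⟨0, hn⟩
  have : Nonempty (Fin n) := ⟨i₀⟩
  set d := Metric.diam Ω
  have hd : 0 < d := by
    have : (nhdsWithin x {x}ᶜ).NeBot := Module.punctured_nhds_neBot ℝ _ x
    exact Metric.diam_pos (infinite_of_mem_nhds x (hΩ.mem_nhds hx)).nontrivial hb
  -- `x` may lie in any orthant, so the cube is opened along the signs of its coordinates.
  let σ : Fin n → ℝ := fun i => if 0 ≤ x i then 1 else -1
  have hσ : ∀ i, |σ i| = 1 := fun i => by
    by_cases h : 0 ≤ x i <;> simp [σ, h]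
  have hσx : ∀ i, 0 ≤ σ i * x i := fun i => by
    by_cases h : 0 ≤ x i
    · simp [σ, h]
    · simpa [σ, h] using (not_le.1 h).le
  have h := setLIntegral_openCube_abs_sub_add_le (σ := σ) (x := x) (S := univ) hn hp hA hD hu hc
    hσ (fun i _ => hσx i) MeasurableSet.univ (fun _ _ => mem_univ _) hd (e := fun _ => d)
    fun _ => ⟨hd.le, le_rfl⟩
  have hmain : ENNReal.ofReal (|u x| * d ^ n) ≤
      ENNReal.ofReal (morreyConst p D n * (2 * d) ^ (n + (1 - D / p)) * N) := by
    refine le_trans (le_of_eq ?_) h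
    rw [ENNReal.ofReal_mul (abs_nonneg _), ← volume_openCube n hd.le, ← setLIntegral_const]
    refine setLIntegral_congr_fun (measurableSet_openCube n d) fun w hw => ?_
    -- A displacement by more than the diameter in one coordinate already leaves `Ω`.
    have hout : orthantMap x σ ((fun _ => d) + w) ∉ Ω := fun hmem => by
      have h1 : dist (orthantMap x σ ((fun _ => d) + w)) x ≤ d :=
        Metric.dist_le_diam_of_mem hb hmem hx
      have h2 := PiLp.norm_apply_le (orthantMap x σ ((fun _ => d) + w) - x) i₀
      rw [dist_eq_norm] at h1
      have h3 := (mem_openCube.1 hw i₀).1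
      simp only [PiLp.sub_apply, orthantMap_apply, add_sub_cancel_left, Real.norm_eq_abs, abs_mul,
        hσ, one_mul, Pi.add_apply] at h2
      linarith [le_abs_self (d + w i₀)]
    have h0 : u (orthantMap x σ ((fun _ => d) + w)) = 0 :=
      image_eq_zero_of_notMem_tsupport fun h => hout (hs h)
    simp [h0]
  rw [ENNReal.ofReal_le_ofReal_iff (by positivity), Real.mul_rpow two_pos.le hd.le,
    Real.rpow_add hd, Real.rpow_natCast] at hmain
  refine le_of_mul_le_mul_right (hmain.trans ?_) (pow_pos hd n)
  rw [holderConst]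
  -- Only one cube was used, so the factor `2` in `holderConst` is spare.
  have : 0 ≤ morreyConst p D n * 2 ^ (n + (1 - D / p)) * d ^ (1 - D / p) * N * d ^ n := by
    positivity
  linarith

end

theorem mainTheorem4 (p D : ℝ) (hp : D < p) :
    ∃ C : ℝ, 0 < C ∧
      ∀ (n : ℕ), 1 ≤ n → ∀ (A : Fin n → ℝ), (∀ i, 0 ≤ A i) → D = (∑ i, A i) + n →
        (∀ u : EuclideanSpace ℝ (Fin n) → ℝ, ContDiff ℝ 1 u → HasCompactSupport u →
          ∀ x ∈ starSpace A, ∀ y ∈ starSpace A, x ≠ y →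
            |u x - u y| / ‖x - y‖ ^ (1 - D / p) ≤ C * weightedGradNorm A p (starSpace A) u) ∧
        (∀ Ω : Set (EuclideanSpace ℝ (Fin n)),
          IsOpen Ω → IsConnected Ω → Bornology.IsBounded Ω →
          ∀ u : EuclideanSpace ℝ (Fin n) → ℝ,
            ContDiff ℝ 1 u → HasCompactSupport u → tsupport u ⊆ Ω →
            ∀ x ∈ Ω, |u x| ≤ C * Metric.diam Ω ^ (1 - D / p) * weightedGradNorm A p Ω u) := by
  have hsum : 0 ≤ ∑ m ∈ Finset.range (⌊D⌋₊ + 1), |holderConst p D m| :=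
    Finset.sum_nonneg fun _ _ => abs_nonneg _
  -- `C` must be chosen before `n`: it dominates every dimension up to `⌊D⌋₊`. The absolute values
  -- and the `1` give positivity for any `p` and `D`.
  refine ⟨1 + ∑ m ∈ Finset.range (⌊D⌋₊ + 1), |holderConst p D m|, by linarith, ?_⟩
  intro n hn A hA hD
  have hle : holderConst p D n ≤ 1 + ∑ m ∈ Finset.range (⌊D⌋₊ + 1), |holderConst p D m| := by
    have hnD : n ≤ ⌊D⌋₊ :=
      Nat.le_floor (by linarith [Finset.sum_nonneg fun i (_ : i ∈ Finset.univ) => hA i])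
    have := Finset.single_le_sum (f := fun m => |holderConst p D m|) (fun _ _ => abs_nonneg _)
      (Finset.mem_range.2 (Nat.lt_succ_of_le hnD))
    linarith [le_abs_self (holderConst p D n)]
  refine ⟨fun u hu hc x hx y hy hxy => ?_, fun Ω hΩ _ hb u hu hc hs x hx => ?_⟩
  · have hr : 0 < ‖x - y‖ ^ (1 - D / p) :=
      Real.rpow_pos_of_pos (norm_pos_iff.2 (sub_ne_zero.2 hxy)) _
    rw [div_le_iff₀ hr, mul_right_comm]
    refine (abs_sub_le_holderConst hn hp hA hD hu hc hx hy hxy).trans ?_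
    have := weightedGradNorm_nonneg A p (starSpace A) u
    gcongr
  · refine (abs_le_holderConst_mul_diam hn hp hA hD hu hc hΩ hb hs hx).trans ?_
    have := weightedGradNorm_nonneg A p Ω u
    gcongr
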